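/- Theorem (Upper bound on target error). Setting: $\mathcal X$ is a measurable space; hypotheses and labelling functions are measurable maps $\mathcal X\to\{0,1\}$. The source domains are pairs $(\mathbb P_{S_i},f_{S_i})$, $i=1,\dots,K$, and the target domain is $(\mathbb P_T,f_T)$, each a probability distribution on $\mathcal X$ with a labelling function. Write $\epsilon_{S_i}(h)=\mathbb E_{x\sim\mathbb P_{S_i}}|h(x)-f_{S_i}(x)|$ and $\epsilon_T(h)=\mathbb E_{x\sim\mathbb P_T}|h(x)-f_T(x)|$. For a class $\mathcal H$ of hypotheses and distributions $P,Q$ put $$d_{\mathcal H\Delta\mathcal H}(P,Q)=2\sup_{h,h'\in\mathcal H}\bigl|P[h(x)\ne h'(x)]-Q[h(x)\ne h'(x)]\bigr| .$$ There is an absolute constant $c>0$ such that the following holds. Let $\mathcal H$ have finite VC dimension $d$, and let $h_T^*\in\mathcal H$ minimize $\epsilon_T$ over $\mathcal H$. Let $\alpha_i\ge 0$, $\sum_i\alpha_i=1$. For each $i$ draw $n_i=\beta_i m$ independent points $x_{i1},\dots,x_{in_i}$ from $\mathbb P_{S_i}$ (independently across $i$), labelled by $f_{S_i}$, where $m=\sum_i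 n_i$ and $n_i\ge 1$ whenever $\alpha_i>0$. Let $\hat h\in\mathcal H$ be an empirical minimizer of the weighted error $$\hat\epsilon_\alpha(h)=\sum_i\alpha_i\,\frac1{n_i}\sum_{j=1}^{n_i}|h(x_{ij})-f_{S_i}(x_{ij})|$$ over $\mathcal H$, chosen measurably: $\hat h(x)$ is jointly measurable in the sample and $x$. (Terms with $\alpha_i=0$ are omitted from $\hat\epsilon_\alpha$ and from the sum in $C$ below.) Then for every $\delta\in(0,1)$ and every mixture $\mathbb P_C=\sum_i\gamma_i\mathbb P_{S_i}$ with $\gamma_i\ge0$, $\sum_i\gamma_i=1$, with probability at least $1-\delta$ over the sample, $$\epsilon_T(\hat h)\le 3\,\epsilon_T(h_T^*)+\lambda+d_{\mathcal H\Delta\mathcal H}(\mathbb P_C,\mathbb P_T)+\max_{i,j}d_{\mathcal H\Delta\mathcal H}(\mathbb P_{S_i},\mathbb P_{S_j})+C(\delta,m,d),$$ where $\lambda=2\sum_i\alpha_i\,\epsilon_{S_i}(h_T^*)$ and $$C(\delta,m,d)=c\,\sqrt{\Bigl(\sum_i\frac{\alpha_i^2}{\beta_i}\Bigr)\,\frac{d\log(2m)-\log\delta}{2m}}\,.$$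 -/

import Mathlib

open MeasureTheory

noncomputable section

namespace MultiSource

/-- The numerical value (0 or 1) of a binary label. -/
def bit (b : Bool) : ℝ := if b then 1 else 0

/-- The error (risk) of the hypothesis `h` with respect to the labelling function `f` under the
input distribution `P`, that is the expectation of `|h(x) - f(x)|`. -/
def risk {X : Type*} [MeasurableSpace X] (P : Measure X) (h f : X → Bool) : ℝ :=
  ∫ x, |bit (h x) - bit (f x)| ∂P

/-- The finite set `s` is shattered by the class `H`: every subset of `s` is cut out by some
hypothesis of the class. -/
def Shatters {X : Type*} (H : Set (X → Bool)) (s : Finset X) : Prop :=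
  ∀ t : Finset X, t ⊆ s → ∃ h ∈ H, ∀ x ∈ s, (h x = true ↔ x ∈ t)

/-- The class `H` has (finite) Vapnik-Chervonenkis dimension `d`. -/
def HasVCDim {X : Type*} (H : Set (X → Bool)) (d : ℕ) : Prop :=
  IsGreatest {k : ℕ | ∃ s : Finset X, s.card = k ∧ Shatters H s} d

/-- The divergence of `P` and `Q` with respect to the symmetric differences of the class `H`: twice
the supremum over pairs of hypotheses of the difference of the disagreement probabilities. -/
def symmDiffDiv {X : Type*} [MeasurableSpace X] (H : Set (X → Bool)) (P Q : Measure X) : ℝ :=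
  2 * ⨆ p : H × H, |P.real {x | p.1.1 x ≠ p.2.1 x} - Q.real {x | p.1.1 x ≠ p.2.1 x}|

/-- The set of all mixtures of the source distributions (their convex hull). -/
def mixtures {X : Type*} [MeasurableSpace X] {K : ℕ} (P : Fin K → Measure X) :
    Set (Measure X) :=
  {Q | ∃ γ ∈ stdSimplex ℝ (Fin K), Q = ∑ i, ENNReal.ofReal (γ i) • P i}

/-- The input points of a multi-source sample with `n i` points from the source `i`. -/
abbrev Sample (X : Type*) {K : ℕ} (n : Fin K → ℕ) : Type _ :=
  (i : Fin K) → Fin (n i) → X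

/-- The law of a sample of independent points, those of the `i`-th block being drawn from `P i`. -/
def sampleLaw {X : Type*} [MeasurableSpace X] {K : ℕ} (P : Fin K → Measure X)
    (n : Fin K → ℕ) : Measure (Sample X n) :=
  Measure.pi fun i => Measure.pi fun _ : Fin (n i) => P i

/-- The `α`-weighted empirical error of `h` on the sample `S`, whose `i`-th block is labelled by
`f i`. -/
def empRisk {X : Type*} {K : ℕ} {n : Fin K → ℕ} (α : Fin K → ℝ) (f : Fin K → X → Bool)
    (S : Sample X n) (h : X → Bool) : ℝ :=
  ∑ i, α i * ((1 / (n i : ℝ)) * ∑ j, |bit (h (S i j)) - bit (f i (S i j))|)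

/-- The total size `m` of a sample with block sizes `n i`. -/
def totalSize {K : ℕ} (n : Fin K → ℕ) : ℕ := ∑ i, n i

/-- The proportion `β i` of the sample that is drawn from the source `i`, so that
`n i = β i * m`. -/
def proportion {K : ℕ} (n : Fin K → ℕ) (i : Fin K) : ℝ := (n i : ℝ) / (totalSize n : ℝ)

/-- The statistical term, without its numerical constant. -/
def statTerm {K : ℕ} (α : Fin K → ℝ) (n : Fin K → ℕ) (δ : ℝ) (d : ℕ) : ℝ :=
  √((∑ i, α i ^ 2 / proportion n i) *
    ((d * Real.log (2 * totalSize n) - Real.log δ) / (2 * totalSize n)))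

end MultiSource

end

noncomputable section

namespace MultiSource

/-! Two independent arguments meet at the end.

Deterministic part (`risk_le_of_sum_risk_le`): let D be the set where ĥ and h_T^* disagree. The
triangle inequality bounds ε_T(ĥ) by P_T(D) + ε_T(h_T^*). Half a divergence moves D from P_T to P_C,
another half from P_C to the α-mixture of sources, and there the triangle inequality through the
source labels bounds its mass by the weighted source errors of ĥ and h_T^*.

Statistical part (`measureReal_excess_le`): the weighted source error of ĥ exceeds that of h_T^* by
at most t with high probability. Symmetrization is applied directly to the learner's output instead
of a supremum over the class, so joint measurability of the learner suffices. Jensen introduces a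
ghost sample, and averaging over all coordinate swaps introduces random signs. The learner sees the
swapped sample, but its labels on the pooled 2m points lie in a Sauer–Shelah set independent of the
signs; summing over that set leaves fixed Rademacher sums. A Chernoff bound
(`measureReal_le_genGap_le`) finishes. -/

/-! ### Growth function of a VC class. -/

/-- Sauer–Shelah: a class of dimension `d` realizes at most `(N + 1) ^ d` labellings of `N`
points. -/
lemma HasVCDim.exists_labellings {X κ : Type*} [Fintype κ] {H : Set (X → Bool)} {d : ℕ}
    (hd : HasVCDim H d) (z : κ → X) :
    ∃ A : Finset (κ → Bool), A.card ≤ (Fintype.card κ + 1) ^ d ∧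
      ∀ h ∈ H, (fun k => h (z k)) ∈ A := by
  classical
  let B : Finset (Finset κ) :=
    Finset.univ.filter fun t => ∃ h ∈ H, ∀ k, k ∈ t ↔ h (z k) = true
  have hdim : B.vcDim ≤ d := by
    refine Finset.sup_le fun s hs => ?_
    rw [Finset.mem_shatterer] at hs
    -- Repeated points receive equal labels, so a shattered index set has distinct points and its
    -- image has the same cardinality.
    have hinj : Set.InjOn z s := by
      intro a ha b hb hab
      by_contra hne
      obtain ⟨u, hu, hsu⟩ := hs (Finset.singleton_subset_iff.2 ha)
      obtain ⟨h, -, hh⟩ := (Finset.mem_filter.1 hu).2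
      have h1 : a ∈ s ∩ u := by simp [hsu]
      have h2 : b ∉ s ∩ u := by simpa [hsu] using Ne.symm hne
      have h3 := (hh a).1 (Finset.mem_inter.1 h1).2
      rw [hab] at h3
      exact h2 (Finset.mem_inter.2 ⟨hb, (hh b).2 h3⟩)
    rw [← Finset.card_image_of_injOn hinj]
    refine hd.2 ⟨s.image z, rfl, fun T _ => ?_⟩
    obtain ⟨u, hu, hsu⟩ := hs (Finset.filter_subset (fun k => z k ∈ T) s)
    obtain ⟨h, hH, hh⟩ := (Finset.mem_filter.1 hu).2
    refine ⟨h, hH, fun x hx => ?_⟩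
    obtain ⟨k, hk, rfl⟩ := Finset.mem_image.1 hx
    have := Finset.ext_iff.1 hsu k
    simp only [Finset.mem_inter, Finset.mem_filter, hk, true_and] at this
    rw [← hh, this]
  refine ⟨B.image fun t k => decide (k ∈ t), ?_, fun h hh => ?_⟩
  · calc (B.image fun t k => decide (k ∈ t)).card ≤ B.card := Finset.card_image_le
      _ ≤ B.shatterer.card := B.card_le_card_shatterer
      _ ≤ ∑ k ∈ Finset.Iic B.vcDim, (Fintype.card κ).choose k :=
        Finset.card_shatterer_le_sum_vcDim
      _ ≤ ∑ k ∈ Finset.Iic d, (Fintype.card κ).choose k :=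
        Finset.sum_le_sum_of_subset (Finset.Iic_subset_Iic.2 hdim)
      _ = ∑ k ∈ Finset.range (d + 1), (Fintype.card κ).choose k :=
        Finset.sum_congr (by ext; simp) fun _ _ => rfl
      -- Inserting the factors `d.choose k ≥ 1` turns the sum into a binomial expansion.
      _ ≤ ∑ k ∈ Finset.range (d + 1), Fintype.card κ ^ k * 1 ^ (d - k) * d.choose k := by
        refine Finset.sum_le_sum fun k hk => ?_
        have : 0 < d.choose k := Nat.choose_pos (Nat.lt_succ_iff.1 (Finset.mem_range.1 hk))
        calc _ ≤ Fintype.card κ ^ k := Nat.choose_le_pow _ _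
          _ ≤ _ := by rw [one_pow, mul_one]; exact Nat.le_mul_of_pos_right _ this
      _ = (Fintype.card κ + 1) ^ d := by simpa using (add_pow (Fintype.card κ) 1 d).symm
  · refine Finset.mem_image.2 ⟨Finset.univ.filter fun k => h (z k) = true, ?_, ?_⟩
    · exact Finset.mem_filter.2 ⟨Finset.mem_univ _, h, hh, fun k => by simp⟩
    · ext k; simp

/-! ### Symmetrization by random swaps. -/

/-- The exponential moment of a Rademacher sum, written as a sum over all signs. -/
lemma sum_exp_signs_le {ι : Type*} [Fintype ι] [DecidableEq ι] (a : ι → ℝ) :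
    ∑ σ : ι → Bool, Real.exp (∑ k, if σ k then -a k else a k) ≤
      2 ^ Fintype.card ι * Real.exp ((∑ k, a k ^ 2) / 2) := by
  have h := Finset.prod_univ_sum (fun _ : ι => (Finset.univ : Finset Bool))
    (fun k b => Real.exp (if b then -a k else a k))
  simp only [Fintype.piFinset_univ, ← Real.exp_sum] at h
  rw [← h, Finset.sum_div, Real.exp_sum, Fintype.card, ← Finset.prod_const,
    ← Finset.prod_mul_distrib]
  refine Finset.prod_le_prod (fun k _ => by positivity) fun k _ => ?_
  have := Real.cosh_le_exp_half_sq (a k)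
  rw [Real.cosh_eq] at this
  simp only [Fintype.sum_bool, if_true, Bool.false_eq_true, if_false]
  linarith

/-- Exchange the coordinates selected by `σ` between two samples. -/
def swapOn {ι X : Type*} (σ : ι → Bool) (p : (ι → X) × (ι → X)) : (ι → X) × (ι → X) :=
  (fun k => if σ k then p.2 k else p.1 k, fun k => if σ k then p.1 k else p.2 k)

/-- Regrouped as a product over coordinates of pairs, the map swaps some pairs of i.i.d. points and
fixes the others. -/
lemma measurePreserving_swapOn {ι X : Type*} [Fintype ι] [MeasurableSpace X]
    (μ : ι → Measure X) [∀ k, IsProbabilityMeasure (μ k)] (σ : ι → Bool) :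
    MeasurePreserving (swapOn σ) ((Measure.pi μ).prod (Measure.pi μ))
      ((Measure.pi μ).prod (Measure.pi μ)) := by
  have e := measurePreserving_arrowProdEquivProdArrow X X ι μ μ
  have hk : ∀ k, MeasurePreserving (fun q : X × X => if σ k then q.swap else q)
      ((μ k).prod (μ k)) ((μ k).prod (μ k)) := by
    intro k
    by_cases h : σ k
    · simpa [h] using Measure.measurePreserving_swap
    · simpa [h] using! MeasurePreserving.id _
  have hs := measurePreserving_pi _ _ hk
  have := (e.comp hs).comp (e.symm _)
  convert this using 1
  funext p
  ext k <;>
  · simp only [swapOn, Function.comp_apply, MeasurableEquiv.arrowProdEquivProdArrow,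
      Equiv.arrowProdEquivProdArrow, MeasurableEquiv.coe_mk, MeasurableEquiv.symm_mk,
      Equiv.coe_fn_mk, Equiv.coe_fn_symm_mk]
    by_cases h : σ k <;> simp [h]

/-- Difference of the total losses of `h` on two samples, for the losses `e k`. -/
def lossGap {ι X : Type*} [Fintype ι] (e : ι → Bool → X → ℝ) (h : X → Bool) (S S' : ι → X) : ℝ :=
  ∑ k, (e k (h (S' k)) (S' k) - e k (h (S k)) (S k))

/-- Difference of the expected total loss of `h` and its total loss on a sample. -/
def genGap {ι X : Type*} [Fintype ι] [MeasurableSpace X] (μ : ι → Measure X)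
    (e : ι → Bool → X → ℝ) (h : X → Bool) (S : ι → X) : ℝ :=
  ∑ k, (∫ x, e k (h x) x ∂μ k - e k (h (S k)) (S k))

/-- The hypothesis varies with σ, so the sign bound does not apply to it directly. Its labelling of
the pooled points lies in a finite set fixed before σ; dominating each term by the sum over this set
decouples labels from signs. -/
lemma sum_exp_lossGap_swapOn_le {ι X : Type*} [Fintype ι] [DecidableEq ι]
    {H : Set (X → Bool)} {d : ℕ}
    (hd : HasVCDim H d) {e : ι → Bool → X → ℝ} {w : ι → ℝ}
    (hw : ∀ k b x, |e k b x| ≤ w k) {A : (ι → X) → X → Bool} (hA : ∀ S, A S ∈ H)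
    (p : (ι → X) × (ι → X)) :
    ∑ σ : ι → Bool, Real.exp (lossGap e (A (swapOn σ p).1) (swapOn σ p).1 (swapOn σ p).2) ≤
      2 ^ Fintype.card ι *
        ((2 * Fintype.card ι + 1) ^ d * Real.exp (2 * ∑ k, w k ^ 2)) := by
  obtain ⟨L, hcard, hL⟩ := hd.exists_labellings (Sum.elim p.1 p.2)
  let a : (ι ⊕ ι → Bool) → ι → ℝ := fun l k =>
    e k (l (Sum.inr k)) (p.2 k) - e k (l (Sum.inl k)) (p.1 k)
  have ha : ∀ l k, a l k ^ 2 ≤ 4 * w k ^ 2 := by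
    intro l k
    have h1 := abs_le.1 (hw k (l (Sum.inr k)) (p.2 k))
    have h2 := abs_le.1 (hw k (l (Sum.inl k)) (p.1 k))
    have : |a l k| ≤ 2 * w k := abs_le.2 ⟨by simp only [a]; linarith, by simp only [a]; linarith⟩
    calc a l k ^ 2 ≤ (2 * w k) ^ 2 := sq_le_sq' (abs_le.1 this).1 (abs_le.1 this).2
      _ = _ := by ring
  -- For a fixed hypothesis, swapping coordinate k only flips the sign of its contribution.
  have key : ∀ σ h, lossGap e h (swapOn σ p).1 (swapOn σ p).2 =
      ∑ k, if σ k then -a (fun j => h (Sum.elim p.1 p.2 j)) k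
        else a (fun j => h (Sum.elim p.1 p.2 j)) k := by
    intro σ h
    refine Finset.sum_congr rfl fun k _ => ?_
    by_cases hs : σ k <;> simp [swapOn, a, hs]
  calc _ ≤ ∑ σ : ι → Bool, ∑ l ∈ L, Real.exp (∑ k, if σ k then -a l k else a l k) := by
        refine Finset.sum_le_sum fun σ _ => ?_
        rw [key]
        exact Finset.single_le_sum
          (f := fun l => Real.exp (∑ k, if σ k then -a l k else a l k))
          (fun l _ => (Real.exp_pos _).le) (hL _ (hA _))
    _ = ∑ l ∈ L, ∑ σ : ι → Bool, Real.exp (∑ k, if σ k then -a l k else a l k) :=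
        Finset.sum_comm
    _ ≤ ∑ l ∈ L, 2 ^ Fintype.card ι * Real.exp (2 * ∑ k, w k ^ 2) := by
        refine Finset.sum_le_sum fun l _ => (sum_exp_signs_le _).trans ?_
        have : ∑ k, a l k ^ 2 ≤ 4 * ∑ k, w k ^ 2 := by
          rw [Finset.mul_sum]; exact Finset.sum_le_sum fun k _ => ha l k
        gcongr
        linarith
    _ = L.card * (2 ^ Fintype.card ι * Real.exp (2 * ∑ k, w k ^ 2)) := by
        rw [Finset.sum_const, nsmul_eq_mul]
    _ ≤ ((2 * Fintype.card ι + 1) ^ d : ℝ) *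
          (2 ^ Fintype.card ι * Real.exp (2 * ∑ k, w k ^ 2)) := by
        have : (L.card : ℝ) ≤ (2 * Fintype.card ι + 1) ^ d := by
          rw [Fintype.card_sum, ← two_mul] at hcard
          exact_mod_cast hcard
        gcongr
    _ = _ := by ring


lemma measurable_lossGap {ι X : Type*} [Fintype ι] [MeasurableSpace X]
    {e : ι → Bool → X → ℝ}
    (he : ∀ k, Measurable fun q : Bool × X => e k q.1 q.2)
    {A : (ι → X) → X → Bool} (hAm : Measurable fun p : (ι → X) × X => A p.1 p.2) :
    Measurable fun p : (ι → X) × (ι → X) => lossGap e (A p.1) p.1 p.2 := by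
  refine Finset.measurable_sum _ fun k _ => Measurable.sub ?_ ?_
  · exact (he k).comp ((hAm.comp (measurable_fst.prodMk
      ((measurable_pi_apply k).comp measurable_snd))).prodMk
      ((measurable_pi_apply k).comp measurable_snd))
  · exact (he k).comp ((hAm.comp (measurable_fst.prodMk
      ((measurable_pi_apply k).comp measurable_fst))).prodMk
      ((measurable_pi_apply k).comp measurable_fst))

lemma measurable_genGap {ι X : Type*} [Fintype ι] [MeasurableSpace X]
    {μ : ι → Measure X} [∀ k, IsProbabilityMeasure (μ k)] {e : ι → Bool → X → ℝ}
    (he : ∀ k, Measurable fun q : Bool × X => e k q.1 q.2)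
    {A : (ι → X) → X → Bool} (hAm : Measurable fun p : (ι → X) × X => A p.1 p.2) :
    Measurable fun S => genGap μ e (A S) S := by
  refine Finset.measurable_sum _ fun k _ => Measurable.sub ?_ ?_
  · have : Measurable fun p : (ι → X) × X => e k (A p.1 p.2) p.2 :=
      (he k).comp (hAm.prodMk measurable_snd)
    exact (this.stronglyMeasurable.integral_prod_right' (ν := μ k)).measurable
  · exact (he k).comp ((hAm.comp (measurable_id.prodMk (measurable_pi_apply k))).prodMk
      (measurable_pi_apply k))

lemma abs_lossGap_le {ι X : Type*} [Fintype ι] {e : ι → Bool → X → ℝ} {w : ι → ℝ}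
    (hw : ∀ k b x, |e k b x| ≤ w k) (h : X → Bool) (S S' : ι → X) :
    |lossGap e h S S'| ≤ 2 * ∑ k, w k := by
  rw [Finset.mul_sum]
  refine (Finset.abs_sum_le_sum_abs _ _).trans (Finset.sum_le_sum fun k _ => ?_)
  refine (abs_sub _ _).trans ?_
  linarith [hw k (h (S' k)) (S' k), hw k (h (S k)) (S k)]

/-! ### Exponential moment and tail of the generalization gap. -/

/-- Jensen's inequality with a ghost sample. -/
lemma exp_genGap_le {ι X : Type*} [Fintype ι] [MeasurableSpace X]
    {μ : ι → Measure X} [∀ k, IsProbabilityMeasure (μ k)] {e : ι → Bool → X → ℝ} {w : ι → ℝ}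
    (he : ∀ k, Measurable fun q : Bool × X => e k q.1 q.2) (hw : ∀ k b x, |e k b x| ≤ w k)
    {h : X → Bool} (hm : Measurable h) (S : ι → X) :
    Real.exp (genGap μ e h S) ≤ ∫ S', Real.exp (lossGap e h S S') ∂Measure.pi μ := by
  have hek : ∀ k, Measurable fun x => e k (h x) x := fun k =>
    (he k).comp (hm.prodMk measurable_id)
  have hei : ∀ k, Integrable (fun S' : ι → X => e k (h (S' k)) (S' k)) (Measure.pi μ) :=
    fun k => Integrable.of_bound ((hek k).comp (measurable_pi_apply k)).aestronglyMeasurable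
      (w k) (Filter.Eventually.of_forall fun _ => hw k _ _)
  have hgap : Measurable fun S' : ι → X => lossGap e h S S' :=
    Finset.measurable_sum _ fun k _ =>
      ((hek k).comp (measurable_pi_apply k)).sub measurable_const
  have hmean : genGap μ e h S = ∫ S', lossGap e h S S' ∂Measure.pi μ := by
    simp only [genGap, lossGap]
    refine Eq.trans ?_ (integral_finsetSum _ fun k _ => (hei k).sub (integrable_const _)).symm
    refine Finset.sum_congr rfl fun k _ => ?_
    refine Eq.trans ?_ (integral_sub (hei k) (integrable_const _)).symm
    have hp := measurePreserving_eval μ k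
    congr 1
    · rw [← hp.map_eq]
      exact integral_map (measurable_pi_apply k).aemeasurable (hek k).aestronglyMeasurable
    · simp
  rw [hmean]
  refine convexOn_exp.map_integral_le Real.continuous_exp.continuousOn isClosed_univ
    (by simp) ?_ ?_
  · exact Integrable.of_bound hgap.aestronglyMeasurable (2 * ∑ k, w k)
      (Filter.Eventually.of_forall fun S' => abs_lossGap_le hw h S S')
  · refine Integrable.of_bound (Real.measurable_exp.comp hgap).aestronglyMeasurable
      (Real.exp (2 * ∑ k, w k)) (Filter.Eventually.of_forall fun S' => ?_)
    simpa using (abs_le.1 (abs_lossGap_le hw h S S')).2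

lemma integrable_exp_genGap {ι X : Type*} [Fintype ι] [MeasurableSpace X]
    {μ : ι → Measure X} [∀ k, IsProbabilityMeasure (μ k)] {e : ι → Bool → X → ℝ} {w : ι → ℝ}
    (he : ∀ k, Measurable fun q : Bool × X => e k q.1 q.2) (hw : ∀ k b x, |e k b x| ≤ w k)
    {A : (ι → X) → X → Bool} (hAm : Measurable fun p : (ι → X) × X => A p.1 p.2) :
    Integrable (fun S => Real.exp (genGap μ e (A S) S)) (Measure.pi μ) := by
  have hmA : ∀ S, Measurable (A S) := fun S => hAm.comp measurable_prodMk_left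
  refine Integrable.of_bound
    (Real.measurable_exp.comp (measurable_genGap he hAm)).aestronglyMeasurable
    (Real.exp (2 * ∑ k, w k)) (Filter.Eventually.of_forall fun S => ?_)
  rw [Real.norm_eq_abs, Real.abs_exp]
  refine (exp_genGap_le he hw (hmA S) S).trans ?_
  calc _ ≤ ∫ _, Real.exp (2 * ∑ k, w k) ∂Measure.pi μ := by
        refine integral_mono_of_nonneg (Filter.Eventually.of_forall fun _ => (Real.exp_pos _).le)
          (integrable_const _) (Filter.Eventually.of_forall fun S' => ?_)
        exact Real.exp_le_exp.2 (abs_le.1 (abs_lossGap_le hw _ S S')).2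
    _ = _ := by simp

/-- Exponential moment of the generalization gap of a jointly measurable learner with values in a
class of dimension `d`. -/
lemma integral_exp_genGap_le {ι X : Type*} [Fintype ι] [MeasurableSpace X]
    {H : Set (X → Bool)} {d : ℕ} (hd : HasVCDim H d)
    {μ : ι → Measure X} [∀ k, IsProbabilityMeasure (μ k)] {e : ι → Bool → X → ℝ} {w : ι → ℝ}
    (he : ∀ k, Measurable fun q : Bool × X => e k q.1 q.2) (hw : ∀ k b x, |e k b x| ≤ w k)
    {A : (ι → X) → X → Bool} (hAm : Measurable fun p : (ι → X) × X => A p.1 p.2)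
    (hA : ∀ S, A S ∈ H) :
    ∫ S, Real.exp (genGap μ e (A S) S) ∂Measure.pi μ ≤
      (2 * Fintype.card ι + 1) ^ d * Real.exp (2 * ∑ k, w k ^ 2) := by
  classical
  have hmA : ∀ S, Measurable (A S) := fun S => hAm.comp measurable_prodMk_left
  set π := Measure.pi μ
  let F : (ι → X) × (ι → X) → ℝ := fun p => Real.exp (lossGap e (A p.1) p.1 p.2)
  have hFm : Measurable F := Real.measurable_exp.comp (measurable_lossGap he hAm)
  have hFi : Integrable F (π.prod π) := by
    refine Integrable.of_bound hFm.aestronglyMeasurable (Real.exp (2 * ∑ k, w k))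
      (Filter.Eventually.of_forall fun p => ?_)
    rw [Real.norm_eq_abs, Real.abs_exp]
    exact Real.exp_le_exp.2 (abs_le.1 (abs_lossGap_le hw _ _ _)).2
  have hghost : ∫ S, Real.exp (genGap μ e (A S) S) ∂π ≤ ∫ p, F p ∂(π.prod π) := by
    rw [integral_prod _ hFi]
    exact integral_mono (integrable_exp_genGap he hw hAm) hFi.integral_prod_left
      fun S => exp_genGap_le he hw (hmA S) S
  have hswap : ∀ σ : ι → Bool, ∫ p, F (swapOn σ p) ∂(π.prod π) = ∫ p, F p ∂(π.prod π) := by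
    intro σ
    have h := measurePreserving_swapOn μ σ
    conv_rhs => rw [← h.map_eq]
    exact (integral_map h.measurable.aemeasurable hFm.aestronglyMeasurable).symm
  have hsum : 2 ^ Fintype.card ι * ∫ p, F p ∂(π.prod π) =
      ∫ p, ∑ σ : ι → Bool, F (swapOn σ p) ∂(π.prod π) := by
    refine Eq.trans ?_ (integral_finsetSum _ fun σ _ =>
      (measurePreserving_swapOn μ σ).integrable_comp_of_integrable hFi).symm
    refine Eq.trans ?_ (Finset.sum_congr rfl fun σ _ => (hswap σ).symm)
    simp
  have hbound : ∫ p, ∑ σ : ι → Bool, F (swapOn σ p) ∂(π.prod π) ≤ 2 ^ Fintype.card ι *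
        ((2 * Fintype.card ι + 1) ^ d * Real.exp (2 * ∑ k, w k ^ 2)) := by
    calc _ ≤ ∫ _, 2 ^ Fintype.card ι *
        ((2 * Fintype.card ι + 1) ^ d * Real.exp (2 * ∑ k, w k ^ 2)) ∂(π.prod π) := by
          refine integral_mono_of_nonneg
            (Filter.Eventually.of_forall fun p => Finset.sum_nonneg fun _ _ => (Real.exp_pos _).le)
            (integrable_const _) (Filter.Eventually.of_forall fun p => ?_)
          exact sum_exp_lossGap_swapOn_le hd hw hA p
      _ = _ := by simp
  rw [← hsum] at hbound
  exact hghost.trans (le_of_mul_le_mul_left hbound (by positivity))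

/-- Tail bound for the generalization gap. -/
lemma measureReal_le_genGap_le {ι X : Type*} [Fintype ι] [MeasurableSpace X]
    {H : Set (X → Bool)} {d : ℕ} (hd : HasVCDim H d)
    {μ : ι → Measure X} [∀ k, IsProbabilityMeasure (μ k)] {e : ι → Bool → X → ℝ} {w : ι → ℝ}
    (he : ∀ k, Measurable fun q : Bool × X => e k q.1 q.2) (hw : ∀ k b x, |e k b x| ≤ w k)
    {A : (ι → X) → X → Bool} (hAm : Measurable fun p : (ι → X) × X => A p.1 p.2)
    (hA : ∀ S, A S ∈ H) {V t : ℝ} (hV : ∑ k, w k ^ 2 = V) (hV0 : 0 < V) (ht : 0 ≤ t) :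
    (Measure.pi μ).real {S | t ≤ genGap μ e (A S) S} ≤
      (2 * Fintype.card ι + 1) ^ d * Real.exp (-t ^ 2 / (8 * V)) := by
  -- This minimizes the Chernoff exponent `-s * t + 2 * s ^ 2 * V`, with value `-t ^ 2 / (8 * V)`.
  set s := t / (4 * V) with hs
  have hs0 : 0 ≤ s := by positivity
  have hgap : ∀ h S, genGap μ (fun k b x => s * e k b x) h S = s * genGap μ e h S := by
    intro h S
    simp only [genGap, Finset.mul_sum, mul_sub, integral_const_mul]
  have he' : ∀ k, Measurable fun q : Bool × X => s * e k q.1 q.2 := fun k => (he k).const_mul s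
  have hw' : ∀ k b x, |s * e k b x| ≤ s * w k := fun k b x => by
    rw [abs_mul, abs_of_nonneg hs0]; exact mul_le_mul_of_nonneg_left (hw k b x) hs0
  have hint := integrable_exp_genGap (μ := μ) he' hw' hAm
  have hmgf := integral_exp_genGap_le (μ := μ) hd he' hw' hAm hA
  simp only [hgap] at hint hmgf
  refine (ProbabilityTheory.measure_ge_le_exp_mul_mgf t hs0 hint).trans ?_
  calc _ ≤ Real.exp (-s * t) *
        ((2 * Fintype.card ι + 1) ^ d * Real.exp (2 * ∑ k, (s * w k) ^ 2)) := by
        gcongr; exact hmgf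
    _ = (2 * Fintype.card ι + 1) ^ d *
          (Real.exp (-s * t) * Real.exp (2 * ∑ k, (s * w k) ^ 2)) := by ring
    _ = _ := by
      rw [← Real.exp_add]
      simp only [mul_pow, ← Finset.mul_sum, hV]
      congr 2
      rw [hs]; field_simp; ring

/-! ### Disagreement probabilities and change of domain. -/

lemma abs_bit_sub_bit (a b : Bool) : |bit a - bit b| = if a ≠ b then 1 else 0 := by
  cases a <;> cases b <;> simp [bit]

lemma measurable_bit : Measurable bit := measurable_of_countable _

lemma measurableSet_disagree {X : Type*} [MeasurableSpace X] {h f : X → Bool}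
    (hh : Measurable h) (hf : Measurable f) : MeasurableSet {x | h x ≠ f x} :=
  (measurableSet_eq_fun hh hf).compl

lemma risk_eq_measureReal {X : Type*} [MeasurableSpace X] (P : Measure X) {h f : X → Bool}
    (hh : Measurable h) (hf : Measurable f) : risk P h f = P.real {x | h x ≠ f x} := by
  rw [← integral_indicator_one (measurableSet_disagree hh hf), risk]
  refine integral_congr_ae (Filter.Eventually.of_forall fun x => ?_)
  simp [abs_bit_sub_bit, Set.indicator_apply]

lemma measureReal_disagree_triangle {X : Type*} [MeasurableSpace X] (P : Measure X)
    [IsFiniteMeasure P] (h g f : X → Bool) :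
    P.real {x | h x ≠ f x} ≤ P.real {x | h x ≠ g x} + P.real {x | g x ≠ f x} := by
  refine (measureReal_mono fun x hx => ?_).trans (measureReal_union_le _ _)
  by_cases hxg : h x = g x
  · exact Or.inr (by simpa [← hxg] using hx)
  · exact Or.inl hxg

lemma measureReal_disagree_sub_le {X : Type*} [MeasurableSpace X] {H : Set (X → Bool)}
    (P Q : Measure X) [IsProbabilityMeasure P] [IsProbabilityMeasure Q]
    {h g : X → Bool} (hh : h ∈ H) (hg : g ∈ H) :
    |P.real {x | h x ≠ g x} - Q.real {x | h x ≠ g x}| ≤ symmDiffDiv H P Q / 2 := by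
  -- Without boundedness the real supremum would take the default value 0.
  have hb : BddAbove (Set.range fun p : H × H =>
      |P.real {x | p.1.1 x ≠ p.2.1 x} - Q.real {x | p.1.1 x ≠ p.2.1 x}|) := by
    refine ⟨1, ?_⟩
    rintro _ ⟨p, rfl⟩
    exact abs_sub_le_of_nonneg_of_le measureReal_nonneg measureReal_le_one
      measureReal_nonneg measureReal_le_one
  have := le_ciSup hb (⟨h, hh⟩, ⟨g, hg⟩)
  simp only [symmDiffDiv]
  linarith

lemma measureReal_mixture {X : Type*} [MeasurableSpace X] {K : ℕ} (P : Fin K → Measure X)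
    [∀ i, IsProbabilityMeasure (P i)] {γ : Fin K → ℝ} (hγ : ∀ i, 0 ≤ γ i) (s : Set X) :
    (∑ i, ENNReal.ofReal (γ i) • P i).real s = ∑ i, γ i * (P i).real s := by
  rw [measureReal_def, Measure.finsetSum_apply, ENNReal.toReal_sum]
  · simp [measureReal_def, hγ]
  · intro i _
    exact ENNReal.mul_ne_top ENNReal.ofReal_ne_top (measure_ne_top _ _)

lemma isProbabilityMeasure_of_mem_mixtures {X : Type*} [MeasurableSpace X] {K : ℕ}
    {P : Fin K → Measure X} [∀ i, IsProbabilityMeasure (P i)] {Q : Measure X}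
    (hQ : Q ∈ mixtures P) : IsProbabilityMeasure Q := by
  obtain ⟨γ, hγ, rfl⟩ := hQ
  refine ⟨?_⟩
  simp only [Measure.finsetSum_apply, Measure.smul_apply, measure_univ, smul_eq_mul, mul_one]
  rw [← ENNReal.ofReal_sum_of_nonneg fun i _ => hγ.1 i, hγ.2, ENNReal.ofReal_one]

/-- The target error of `h` is controlled by its weighted source error and the divergences. -/
lemma risk_le_of_sum_risk_le {X : Type*} [MeasurableSpace X] {H : Set (X → Bool)}
    (hH : ∀ h ∈ H, Measurable h) {K : ℕ} {P : Fin K → Measure X}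
    [∀ i, IsProbabilityMeasure (P i)] {f : Fin K → X → Bool} (hf : ∀ i, Measurable (f i))
    {Q : Measure X} [IsProbabilityMeasure Q] {g : X → Bool} (hg : Measurable g)
    {α : Fin K → ℝ} (hα : α ∈ stdSimplex ℝ (Fin K)) {R : Measure X} (hR : R ∈ mixtures P)
    {h h' : X → Bool} (hh : h ∈ H) (hh' : h' ∈ H) {t : ℝ}
    (ht : ∑ i, α i * risk (P i) h (f i) ≤ ∑ i, α i * risk (P i) h' (f i) + t) :
    risk Q h g ≤ risk Q h' g + 2 * ∑ i, α i * risk (P i) h' (f i) + symmDiffDiv H R Q / 2 +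
      (⨆ i, ⨆ j, symmDiffDiv H (P i) (P j)) / 2 + t := by
  have := isProbabilityMeasure_of_mem_mixtures hR
  set D := {x | h x ≠ h' x} with hD
  set M := ⨆ i, ⨆ j, symmDiffDiv H (P i) (P j) with hM
  have hM' : ∀ i j, symmDiffDiv H (P i) (P j) ≤ M := fun i j =>
    (le_ciSup (f := fun j => symmDiffDiv H (P i) (P j)) (Set.finite_range _).bddAbove j).trans
      (le_ciSup (f := fun i => ⨆ j, symmDiffDiv H (P i) (P j)) (Set.finite_range _).bddAbove i)
  have h1 : risk Q h g ≤ Q.real D + risk Q h' g := by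
    rw [risk_eq_measureReal Q (hH h hh) hg, risk_eq_measureReal Q (hH h' hh') hg]
    exact measureReal_disagree_triangle Q h h' g
  have h2 : Q.real D ≤ R.real D + symmDiffDiv H R Q / 2 := by
    have := (abs_le.1 (measureReal_disagree_sub_le R Q hh hh')).1
    linarith
  -- Averaging the pairwise comparisons over j with weights α replaces one source by the α-mixture;
  -- `h3` then averages over i with weights γ.
  have hPD : ∀ i, (P i).real D ≤ ∑ j, α j * (P j).real D + M / 2 := by
    intro i
    calc (P i).real D = ∑ j, α j * (P i).real D := by rw [← Finset.sum_mul, hα.2, one_mul]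
      _ ≤ ∑ j, α j * ((P j).real D + M / 2) := by
        refine Finset.sum_le_sum fun j _ => mul_le_mul_of_nonneg_left ?_ (hα.1 j)
        have := (abs_le.1 (measureReal_disagree_sub_le (P i) (P j) hh hh')).2
        linarith [hM' i j]
      _ = _ := by simp only [mul_add, Finset.sum_add_distrib, ← Finset.sum_mul, hα.2, one_mul]
  have h3 : R.real D ≤ ∑ j, α j * (P j).real D + M / 2 := by
    obtain ⟨γ, hγ, rfl⟩ := hR
    rw [measureReal_mixture P hγ.1]
    calc _ ≤ ∑ i, γ i * (∑ j, α j * (P j).real D + M / 2) :=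
          Finset.sum_le_sum fun i _ => mul_le_mul_of_nonneg_left (hPD i) (hγ.1 i)
      _ = _ := by rw [← Finset.sum_mul, hγ.2, one_mul]
  have h4 : ∑ j, α j * (P j).real D ≤
      ∑ j, α j * risk (P j) h (f j) + ∑ j, α j * risk (P j) h' (f j) := by
    rw [← Finset.sum_add_distrib]
    refine Finset.sum_le_sum fun j _ => ?_
    rw [← mul_add, risk_eq_measureReal _ (hH h hh) (hf j),
      risk_eq_measureReal _ (hH h' hh') (hf j)]
    refine mul_le_mul_of_nonneg_left ?_ (hα.1 j)
    refine (measureReal_disagree_triangle (P j) h (f j) h').trans (le_of_eq ?_)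
    simp only [ne_comm]
  linarith

lemma symmDiffDiv_nonneg {X : Type*} [MeasurableSpace X] (H : Set (X → Bool))
    (P Q : Measure X) : 0 ≤ symmDiffDiv H P Q :=
  mul_nonneg zero_le_two (Real.iSup_nonneg fun _ => abs_nonneg _)

/-! ### The weighted multi-source sample. -/

/-- Excess loss of the label `b` over the hypothesis `h'` at one point of the weighted sample. -/
def excessLoss {X : Type*} {K : ℕ} (n : Fin K → ℕ) (α : Fin K → ℝ) (f : Fin K → X → Bool)
    (h' : X → Bool) (k : Σ i, Fin (n i)) (b : Bool) (x : X) : ℝ :=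
  α k.1 / n k.1 * (|bit b - bit (f k.1 x)| - |bit (h' x) - bit (f k.1 x)|)

lemma measurable_excessLoss {X : Type*} [MeasurableSpace X] {K : ℕ} (n : Fin K → ℕ)
    (α : Fin K → ℝ) {f : Fin K → X → Bool} (hf : ∀ i, Measurable (f i)) {h' : X → Bool}
    (hh' : Measurable h') (k : Σ i, Fin (n i)) :
    Measurable fun q : Bool × X => excessLoss n α f h' k q.1 q.2 := by
  have h1 : Measurable fun q : Bool × X => bit q.1 := measurable_bit.comp measurable_fst
  have h2 : Measurable fun q : Bool × X => bit (f k.1 q.2) :=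
    measurable_bit.comp ((hf _).comp measurable_snd)
  have h3 : Measurable fun q : Bool × X => bit (h' q.2) :=
    measurable_bit.comp (hh'.comp measurable_snd)
  unfold excessLoss
  exact ((h1.sub h2).abs.sub (h3.sub h2).abs).const_mul _

lemma abs_excessLoss_le {X : Type*} {K : ℕ} (n : Fin K → ℕ)
    {α : Fin K → ℝ} (hα : ∀ i, 0 ≤ α i) (f : Fin K → X → Bool) (h' : X → Bool)
    (k : Σ i, Fin (n i)) (b : Bool) (x : X) :
    |excessLoss n α f h' k b x| ≤ α k.1 / n k.1 := by
  have h0 : 0 ≤ α k.1 / n k.1 := div_nonneg (hα _) (Nat.cast_nonneg _)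
  rw [excessLoss, abs_mul, abs_of_nonneg h0]
  refine mul_le_of_le_one_right h0 ?_
  rw [abs_bit_sub_bit, abs_bit_sub_bit]
  split_ifs <;> simp

/-- Building the comparison with `h'` into the loss makes one tail bound control both hypotheses,
with no separate concentration argument for `h'`. -/
lemma genGap_excessLoss {X : Type*} [MeasurableSpace X] {K : ℕ} {P : Fin K → Measure X}
    [∀ i, IsProbabilityMeasure (P i)] {n : Fin K → ℕ} {α : Fin K → ℝ}
    (hn : ∀ i, α i ≠ 0 → 0 < n i) {f : Fin K → X → Bool} (hf : ∀ i, Measurable (f i))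
    {h h' : X → Bool} (hh : Measurable h) (hh' : Measurable h') (S : Sample X n) :
    genGap (fun k : Σ i, Fin (n i) => P k.1) (excessLoss n α f h') h (fun k => S k.1 k.2) =
      (∑ i, α i * risk (P i) h (f i) - ∑ i, α i * risk (P i) h' (f i)) -
        (empRisk α f S h - empRisk α f S h') := by
  have hint : ∀ i {g : X → Bool}, Measurable g →
      Integrable (fun x => |bit (g x) - bit (f i x)|) (P i) := by
    intro i g hg
    refine Integrable.of_bound ((measurable_bit.comp hg).sub
      (measurable_bit.comp (hf i))).abs.aestronglyMeasurable 1
      (Filter.Eventually.of_forall fun x => ?_)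
    rw [abs_bit_sub_bit]; split_ifs <;> simp
  simp only [genGap, excessLoss, empRisk]
  rw [Fintype.sum_sigma, ← Finset.sum_sub_distrib, ← Finset.sum_sub_distrib,
    ← Finset.sum_sub_distrib]
  refine Finset.sum_congr rfl fun i _ => ?_
  have hI : ∫ x, α i / n i * (|bit (h x) - bit (f i x)| - |bit (h' x) - bit (f i x)|) ∂P i =
      α i / n i * (risk (P i) h (f i) - risk (P i) h' (f i)) := by
    rw [integral_const_mul, integral_sub (hint i hh) (hint i hh')]; rfl
  simp only [hI, Finset.sum_sub_distrib, ← Finset.mul_sum, Finset.sum_const, Finset.card_univ,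
    Fintype.card_fin, nsmul_eq_mul]
  by_cases h0 : α i = 0
  · simp [h0]
  · have : (n i : ℝ) ≠ 0 := by exact_mod_cast (hn i h0).ne'
    field_simp

/-- Flattens the blocks into one family of independent points, the setting of the tail bound. -/
lemma sampleLaw_eq_map {X : Type*} [MeasurableSpace X] {K : ℕ} (P : Fin K → Measure X)
    [∀ i, IsProbabilityMeasure (P i)] (n : Fin K → ℕ) :
    sampleLaw P n = (Measure.pi fun k : Σ i, Fin (n i) => P k.1).map
      (MeasurableEquiv.piCurry fun _ _ => X) := by
  have := Measure.infinitePi_map_piCurry (X := fun i (_ : Fin (n i)) => X)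
    (fun i (_ : Fin (n i)) => P i)
  simp only [Measure.infinitePi_eq_pi] at this
  exact this.symm

/-- Tail bound for the excess weighted source error of an empirical minimizer. -/
lemma measureReal_excess_le {X : Type*} [MeasurableSpace X] {H : Set (X → Bool)}
    (hH : ∀ h ∈ H, Measurable h) {d : ℕ} (hd : HasVCDim H d) {K : ℕ} {P : Fin K → Measure X}
    [∀ i, IsProbabilityMeasure (P i)] {f : Fin K → X → Bool} (hf : ∀ i, Measurable (f i))
    {h' : X → Bool} (hh' : h' ∈ H) {α : Fin K → ℝ} (hα : ∀ i, 0 ≤ α i) {n : Fin K → ℕ}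
    (hn : ∀ i, α i ≠ 0 → 0 < n i) {A : Sample X n → X → Bool}
    (hAm : Measurable fun p : Sample X n × X => A p.1 p.2) (hA : ∀ S, A S ∈ H)
    (hmin : ∀ S, empRisk α f S (A S) ≤ empRisk α f S h')
    (hV : 0 < ∑ i, α i ^ 2 / n i) {t : ℝ} (ht : 0 ≤ t) :
    1 - (2 * totalSize n + 1) ^ d * Real.exp (-t ^ 2 / (8 * ∑ i, α i ^ 2 / n i)) ≤
      (sampleLaw P n).real {S | ∑ i, α i * risk (P i) (A S) (f i) ≤
        ∑ i, α i * risk (P i) h' (f i) + t} := by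
  let c := MeasurableEquiv.piCurry (fun i (_ : Fin (n i)) => X)
  let μ : (Σ i, Fin (n i)) → Measure X := fun k => P k.1
  let e := excessLoss n α f h'
  let B : ((Σ i, Fin (n i)) → X) → X → Bool := fun S => A (c S)
  have he := measurable_excessLoss n α hf (hH h' hh')
  have hBm : Measurable fun p : ((Σ i, Fin (n i)) → X) × X => B p.1 p.2 :=
    hAm.comp ((c.measurable.comp measurable_fst).prodMk measurable_snd)
  have hsq : ∑ k : Σ i, Fin (n i), (α k.1 / n k.1) ^ 2 = ∑ i, α i ^ 2 / n i := by
    rw [Fintype.sum_sigma]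
    refine Finset.sum_congr rfl fun i _ => ?_
    simp only [Finset.sum_const, Finset.card_univ, Fintype.card_fin, nsmul_eq_mul]
    -- A block of weight zero may be empty; both sides then vanish.
    by_cases h0 : α i = 0
    · simp [h0]
    · have : (n i : ℝ) ≠ 0 := by exact_mod_cast (hn i h0).ne'
      field_simp
  have htail := measureReal_le_genGap_le hd (μ := μ) he (abs_excessLoss_le n hα f h') hBm
    (fun S => hA (c S)) hsq hV ht
  have hcard : (Fintype.card (Σ i, Fin (n i)) : ℝ) = totalSize n := by
    simp [totalSize]
  rw [hcard] at htail
  have hms : MeasurableSet {S | t ≤ genGap μ e (B S) S} :=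
    measurableSet_le measurable_const (measurable_genGap he hBm)
  have : IsProbabilityMeasure ((Measure.pi μ).map c) :=
    Measure.isProbabilityMeasure_map c.measurable.aemeasurable
  rw [sampleLaw_eq_map]
  rw [measureReal_def, MeasurableEquiv.map_apply, ← measureReal_def]
  have hcompl := probReal_compl_eq_one_sub (μ := Measure.pi μ) hms
  refine le_trans ?_ (measureReal_mono (s₁ := {S | t ≤ genGap μ e (B S) S}ᶜ) ?_)
  · rw [hcompl]; linarith
  · intro S hS
    have hS : genGap μ e (B S) S < t := not_le.1 hS
    have hg := genGap_excessLoss (P := P) hn hf (hH _ (hA (c S))) (hH h' hh') (c S)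
    have hg' : genGap μ e (B S) S = _ := hg
    simp only [Set.mem_preimage, Set.mem_ofPred_eq]
    rw [hg'] at hS
    -- The empirical excess over `h'` is nonpositive, so the gap dominates the true excess.
    have := hmin (c S)
    change ∑ i, α i * risk (P i) (A (c S)) (f i) ≤ _
    linarith

/-! ### Numerical constants and conclusion. -/

lemma statTerm_eq {K : ℕ} (α : Fin K → ℝ) (n : Fin K → ℕ) (δ : ℝ) (d : ℕ)
    (hm : 0 < totalSize n) :
    statTerm α n δ d =
      √((∑ i, α i ^ 2 / n i) * (d * Real.log (2 * totalSize n) - Real.log δ) / 2) := by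
  have hm' : (totalSize n : ℝ) ≠ 0 := by exact_mod_cast hm.ne'
  have : ∑ i, α i ^ 2 / proportion n i = (∑ i, α i ^ 2 / n i) * totalSize n := by
    rw [Finset.sum_mul]
    refine Finset.sum_congr rfl fun i _ => ?_
    rw [proportion, div_div_eq_mul_div, div_mul_eq_mul_div]
  rw [statTerm, this]
  congr 1
  field_simp

lemma growth_mul_exp_le {m d : ℕ} (hm : 0 < m) {δ : ℝ} (hδ0 : 0 < δ) (hδ1 : δ < 1) :
    (2 * m + 1 : ℝ) ^ d * Real.exp (-(4 * (d * Real.log (2 * m) - Real.log δ))) ≤ δ := by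
  have hm1 : (1 : ℝ) ≤ m := by exact_mod_cast hm
  have hl : 0 ≤ Real.log (2 * m) := Real.log_nonneg (by linarith)
  have hlδ : Real.log δ < 0 := Real.log_neg hδ0 hδ1
  -- This is 2m + 1 ≤ (2m)², so half of the exponent's `d * log (2m)` term absorbs the growth
  -- function.
  have h1 : (2 * m + 1 : ℝ) ≤ Real.exp (2 * Real.log (2 * m)) := by
    rw [two_mul (Real.log _), Real.exp_add, Real.exp_log (by linarith)]
    nlinarith
  calc _ ≤ Real.exp (2 * Real.log (2 * m)) ^ d *
        Real.exp (-(4 * (d * Real.log (2 * m) - Real.log δ))) := by gcongr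
    _ = Real.exp (-(2 * (d * Real.log (2 * m))) + 4 * Real.log δ) := by
      rw [← Real.exp_nat_mul, ← Real.exp_add]; congr 1; ring
    _ ≤ Real.exp (Real.log δ) := by
      have : 0 ≤ d * Real.log (2 * m) := by positivity
      exact Real.exp_le_exp.2 (by linarith)
    _ = δ := Real.exp_log hδ0

end MultiSource

end

theorem mainTheorem2 :
    ∃ c : ℝ, 0 < c ∧
      ∀ (X : Type*) [MeasurableSpace X]
        -- the hypothesis class and its dimension
        (H : Set (X → Bool)) (_ : ∀ h ∈ H, Measurable h)
        (d : ℕ) (_ : MultiSource.HasVCDim H d)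
        -- the source domains
        (K : ℕ) (PS : Fin K → Measure X) (_ : ∀ i, IsProbabilityMeasure (PS i))
        (fS : Fin K → X → Bool) (_ : ∀ i, Measurable (fS i))
        -- the target domain
        (PT : Measure X) (_ : IsProbabilityMeasure PT)
        (fT : X → Bool) (_ : Measurable fT)
        -- the target error minimizer
        (hT : X → Bool) (_ : hT ∈ H)
        (_ : ∀ h ∈ H, MultiSource.risk PT hT fT ≤ MultiSource.risk PT h fT)
        -- the weights and the block sizes of the sample
        (α : Fin K → ℝ) (_ : α ∈ stdSimplex ℝ (Fin K))
        (n : Fin K → ℕ) (_ : ∀ i, α i ≠ 0 → 0 < n i)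
        -- the (measurable) empirical risk minimizer
        (hhat : MultiSource.Sample X n → X → Bool)
        (_ : Measurable fun p : MultiSource.Sample X n × X => hhat p.1 p.2)
        (_ : ∀ S, hhat S ∈ H)
        (_ : ∀ S, ∀ h ∈ H,
          MultiSource.empRisk α fS S (hhat S) ≤ MultiSource.empRisk α fS S h)
        (δ : ℝ) (_ : 0 < δ) (_ : δ < 1)
        (PC : Measure X) (_ : PC ∈ MultiSource.mixtures PS),
        1 - δ ≤ (MultiSource.sampleLaw PS n).real
          {S | MultiSource.risk PT (hhat S) fT ≤
            3 * MultiSource.risk PT hT fT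
            + 2 * ∑ i, α i * MultiSource.risk (PS i) hT (fS i)
            + MultiSource.symmDiffDiv H PC PT
            + (⨆ i, ⨆ j, MultiSource.symmDiffDiv H (PS i) (PS j))
            + c * MultiSource.statTerm α n δ d} := by
  -- With t = 8√(VL/2) the tail exponent t²/(8V) equals 4L, as `growth_mul_exp_le` needs.
  refine ⟨8, by norm_num, ?_⟩
  intro X _ H hH d hd K PS _ fS hfS PT _ fT hfT hT hTH _ α hα n hn hhat hhm hhH hmin δ hδ0 hδ1
    PC hPC
  obtain ⟨i₀, hi₀⟩ : ∃ i, α i ≠ 0 := by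
    by_contra! h
    simpa [h] using hα.2
  have hni : 0 < n i₀ := hn i₀ hi₀
  have hm : 0 < MultiSource.totalSize n :=
    hni.trans_le (Finset.single_le_sum (f := n) (fun _ _ => Nat.zero_le _) (Finset.mem_univ i₀))
  have hV : 0 < ∑ i, α i ^ 2 / n i :=
    Finset.sum_pos' (fun i _ => by positivity) ⟨i₀, Finset.mem_univ _, by positivity⟩
  set V := ∑ i, α i ^ 2 / n i with hVdef
  set L := d * Real.log (2 * MultiSource.totalSize n) - Real.log δ with hL
  have hL0 : 0 ≤ L := by
    have hm1 : (1 : ℝ) ≤ MultiSource.totalSize n := by exact_mod_cast hm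
    have h1 : 0 ≤ Real.log (2 * MultiSource.totalSize n) := Real.log_nonneg (by linarith)
    have h2 := Real.log_neg hδ0 hδ1
    have : 0 ≤ d * Real.log (2 * MultiSource.totalSize n) := by positivity
    linarith
  have hst : MultiSource.statTerm α n δ d = √(V * L / 2) := MultiSource.statTerm_eq α n δ d hm
  have htail := MultiSource.measureReal_excess_le hH hd (P := PS) hfS hTH hα.1 hn hhm hhH
    (fun S => hmin S hT hTH) hV (t := 8 * MultiSource.statTerm α n δ d)
    (by rw [hst]; positivity)
  have hexp : -(8 * MultiSource.statTerm α n δ d) ^ 2 / (8 * V) = -(4 * L) := by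
    rw [hst, mul_pow, Real.sq_sqrt (by positivity)]
    field_simp
    ring
  rw [hexp] at htail
  have hgrowth := MultiSource.growth_mul_exp_le (d := d) hm hδ0 hδ1
  have : IsProbabilityMeasure (MultiSource.sampleLaw PS n) := by
    unfold MultiSource.sampleLaw; infer_instance
  refine le_trans (le_trans ?_ htail) (measureReal_mono fun S hS => ?_)
  · linarith
  -- The deterministic bound is sharper (coefficient 1 on the target error, halved divergences);
  -- nonnegativity of these terms gives the stated form.
  · have hdet := MultiSource.risk_le_of_sum_risk_le hH (P := PS) hfS (Q := PT) hfT hα hPC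
      (hhH S) hTH hS
    have h1 := MultiSource.symmDiffDiv_nonneg H PC PT
    have h2 : 0 ≤ ⨆ i, ⨆ j, MultiSource.symmDiffDiv H (PS i) (PS j) :=
      Real.iSup_nonneg fun _ => Real.iSup_nonneg fun _ => MultiSource.symmDiffDiv_nonneg H _ _
    have h3 : 0 ≤ MultiSource.risk PT hT fT := integral_nonneg fun _ => abs_nonneg _
    simp only [Set.mem_ofPred_eq]
    linarith
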